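/- For finite loopless undirected graphs $G,H$, let $\mathrm{Hom}(G,H)$ be the polyhedral complex whose cells are indexed by the functions $\eta:V(G)\to 2^{V(H)}\setminus\{\varnothing\}$ such that $(x,y)\in E(G)$ implies $(\tilde x,\tilde y)\in E(H)$ for all $\tilde x\in\eta(x)$, $\tilde y\in\eta(y)$; the closed cell of $\eta$ is the product of simplices $\prod_{v\in V(G)}\Delta^{\eta(v)}$, and it consists of the cells $\sigma$ with $\sigma(v)\subseteq\eta(v)$ for all $v\in V(G)$. Let $K_m$ be the complete graph on $m$ vertices. **Proposition 3.3.** Let $n\ge 0$ be an integer. The complex $\mathrm{Hom}(K_n,K_{n+1})$ is a graph (all its cells have dimension at most $1$); it is path-connected, has $v=(n+1)!$ vertices, and is $n$-regular (each vertex lies on exactly $n$ edges). For every base point, the fundamental group $\pi_1(\mathrm{Hom}(K_n,K_{n+1}))$ is a free group of rank $$\alpha_n=\frac{n!\,(n^2-n-2)}{2}+1=e-v+1,$$ where $e$ is the number of edges of $\mathrm{Hom}(K_n,K_{n+1})$. -/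

import Mathlib

/-- A cell of the complex `Hom(G, H)`: a function `η` from the vertices of `G` to the nonempty
sets of vertices of `H` such that, whenever `x` and `y` are adjacent in `G`, every element of
`η x` is adjacent in `H` to every element of `η y`. -/
@[ext]
structure HomCell {V W : Type*} (G : SimpleGraph V) (H : SimpleGraph W) where
  color : V → Finset W
  nonempty : ∀ v, (color v).Nonempty
  adj : ∀ x y, G.Adj x y → ∀ a ∈ color x, ∀ b ∈ color y, H.Adj a b

/-- The cell `σ` lies in the closure of the cell `η`. -/
def HomCell.IsFace {V W : Type*} {G : SimpleGraph V} {H : SimpleGraph W}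
    (σ η : HomCell G H) : Prop :=
  ∀ v, σ.color v ⊆ η.color v

/-- The dimension of the cell `η`, i.e. of the product over the vertices `v` of `G` of the simplex
with vertex set `η v`. As the sets `η v` are nonempty, the subtraction is not truncated, and the
sum is the total size of the sets `η v` minus the number of vertices of `G`. -/
def HomCell.dim {V W : Type*} [Fintype V] {G : SimpleGraph V} {H : SimpleGraph W}
    (η : HomCell G H) : ℕ :=
  ∑ v, ((η.color v).card - 1)

/-- The closed cell indexed by `η`, realized as a product of simplices: the families `t` of
points `t v` of the standard simplex on the vertices of `H`, such that `t v` lies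
in the face spanned by `η v`. -/
def HomCell.closedCell {V W : Type*} [Fintype W] {G : SimpleGraph V} {H : SimpleGraph W}
    (η : HomCell G H) : Set (V → W → ℝ) :=
  {t | ∀ v, t v ∈ stdSimplex ℝ W ∧ ∀ w, w ∉ η.color v → t v w = 0}

/-- The polyhedral complex `Hom(G, H)` of two finite graphs, as a subspace of the product over the
vertices of `G` of the standard simplex on the vertices of `H`: the union of its closed cells. -/
def homComplex {V W : Type*} [Finite V] [Fintype W] (G : SimpleGraph V) (H : SimpleGraph W) :
    Set (V → W → ℝ) :=
  ⋃ η : HomCell G H, η.closedCell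

/-- The complete graph `K_n` on `n` vertices (without loops). -/
abbrev completeGraphK (n : ℕ) : SimpleGraph (Fin n) := ⊤

/-! Distinct vertices of `K_n` have disjoint colour sets, so their sizes add up to at most `n + 1`.
Hence a cell is either an injection of `Fin n` into `Fin (n + 1)`, or a pair of injections that
differ at one place, and the complex realizes the graph `injectionGraph n`. An injection misses
exactly one value and its neighbours arise by moving one of the `n` places there. This gives degree
`n` and `2e = n (n + 1)!`; connectedness is a sliding puzzle (`reachable_castSuccEmb`).

For the fundamental group, the open stars of the vertices form an `IsGraphCover`: they are
contractible, they meet in path-connected sets along edges, and no three of them meet. For every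
space with such a cover by a finite connected graph, the fundamental group is free on the `e - (v -
1)` edges outside a spanning tree. The map `ofFreeGroup` sends such an edge to the loop through it
that is closed up in the tree. It is surjective because every path is a product of local paths
(`induction_on`). It is injective because a covering whose fibre is the free group can be glued with
transition 1 along tree edges and a generator along each other edge; the loop of a word `g` has
monodromy left multiplication by `g`, so it determines `g`. -/

open CategoryTheory

/-! ### Path classes inside simply connected sets -/

namespace IsSimplyConnected

variable {X : Type*} [TopologicalSpace X] {s t : Set X}

/-- The homotopy class in the ambient space of the paths that join `x` to `y` in the simply
connected set `s`. -/
noncomputable def pathClass (hs : IsSimplyConnected s) {x y : X} (hx : x ∈ s) (hy : y ∈ s) :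
    FundamentalGroupoid.mk x ⟶ FundamentalGroupoid.mk y :=
  Path.Homotopic.Quotient.mk (hs.isPathConnected.joinedIn x hx y hy).somePath

theorem mk_eq_pathClass (hs : IsSimplyConnected s) {x y : X} (hx : x ∈ s) (hy : y ∈ s)
    (γ : Path x y) (hγ : ∀ i, γ i ∈ s) :
    Path.Homotopic.Quotient.mk γ = hs.pathClass hx hy := by
  have := hs.simplyConnectedSpace
  let lift (δ : Path x y) (hδ : ∀ i, δ i ∈ s) : Path (⟨x, hx⟩ : s) ⟨y, hy⟩ :=
    { toFun := fun i => ⟨δ i, hδ i⟩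
      continuous_toFun := by fun_prop
      source' := by simp
      target' := by simp }
  have hδ := (hs.isPathConnected.joinedIn x hx y hy).somePath_mem
  have h := SimplyConnectedSpace.paths_homotopic (lift γ hγ) (lift _ hδ)
  exact Path.Homotopic.Quotient.eq.2 (h.map ⟨Subtype.val, continuous_subtype_val⟩)

theorem pathClass_comp (hs : IsSimplyConnected s) {x y z : X} (hx : x ∈ s) (hy : y ∈ s)
    (hz : z ∈ s) : hs.pathClass hx hy ≫ hs.pathClass hy hz = hs.pathClass hx hz := by
  have h₁ := (hs.isPathConnected.joinedIn x hx y hy).somePath_mem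
  have h₂ := (hs.isPathConnected.joinedIn y hy z hz).somePath_mem
  refine hs.mk_eq_pathClass hx hz ((hs.isPathConnected.joinedIn x hx y hy).somePath.trans
    (hs.isPathConnected.joinedIn y hy z hz).somePath) fun i => ?_
  rw [Path.trans_apply]
  split_ifs
  · exact h₁ _
  · exact h₂ _

theorem pathClass_self (hs : IsSimplyConnected s) {x : X} (hx : x ∈ s) :
    hs.pathClass hx hx = 𝟙 _ :=
  (hs.mk_eq_pathClass hx hx (Path.refl x) fun _ => hx).symm

theorem inv_pathClass (hs : IsSimplyConnected s) {x y : X} (hx : x ∈ s) (hy : y ∈ s) :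
    inv (hs.pathClass hx hy) = hs.pathClass hy hx :=
  IsIso.inv_eq_of_hom_inv_id (by rw [pathClass_comp, pathClass_self])

/-- A path inside `s ∩ t` represents both classes. -/
theorem pathClass_eq_pathClass (hs : IsSimplyConnected s) (ht : IsSimplyConnected t)
    (hst : IsPathConnected (s ∩ t)) {x y : X} (hx : x ∈ s ∩ t) (hy : y ∈ s ∩ t) :
    hs.pathClass hx.1 hy.1 = ht.pathClass hx.2 hy.2 := by
  have h := (hst.joinedIn x hx y hy).somePath_mem
  rw [← hs.mk_eq_pathClass hx.1 hy.1 _ fun i => (h i).1,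
    ← ht.mk_eq_pathClass hx.2 hy.2 _ fun i => (h i).2]

end IsSimplyConnected

/-! ### Covers modelled on a graph, and paths through them -/

/-- An open cover of `X` by simply connected sets, indexed by the vertices of a graph, such that
two of the sets meet in a path-connected set or are disjoint, according to whether their indices are
adjacent or not, and no three of them meet. -/
structure IsGraphCover {X V : Type*} [TopologicalSpace X] (Γ : SimpleGraph V) (U : V → Set X) :
    Prop where
  isOpen : ∀ v, IsOpen (U v)
  exists_mem : ∀ x, ∃ v, x ∈ U v
  isSimplyConnected : ∀ v, IsSimplyConnected (U v)
  isPathConnected_inter : ∀ {v w}, Γ.Adj v w → IsPathConnected (U v ∩ U w)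
  adj : ∀ {v w x}, x ∈ U v → x ∈ U w → v ≠ w → Γ.Adj v w
  eq_or_eq_or_eq : ∀ {u v w x}, x ∈ U u → x ∈ U v → x ∈ U w → u = v ∨ v = w ∨ u = w

namespace IsGraphCover

variable {X V : Type*} [TopologicalSpace X] {Γ : SimpleGraph V} {U : V → Set X}

/-- A point of the set with index `v`. -/
noncomputable def center (h : IsGraphCover Γ U) (v : V) : X :=
  (h.isSimplyConnected v).nonempty.some

theorem center_mem (h : IsGraphCover Γ U) (v : V) : h.center v ∈ U v :=
  (h.isSimplyConnected v).nonempty.some_mem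

/-- The homotopy class of the paths from `x` to `y` in `U v`. -/
noncomputable def localClass (h : IsGraphCover Γ U) (v : V) {x y : X} (hx : x ∈ U v)
    (hy : y ∈ U v) : FundamentalGroupoid.mk x ⟶ FundamentalGroupoid.mk y :=
  (h.isSimplyConnected v).pathClass hx hy

theorem mk_eq_localClass (h : IsGraphCover Γ U) {v : V} {x y : X} (hx : x ∈ U v) (hy : y ∈ U v)
    (γ : Path x y) (hγ : ∀ i, γ i ∈ U v) :
    Path.Homotopic.Quotient.mk γ = h.localClass v hx hy :=
  IsSimplyConnected.mk_eq_pathClass _ hx hy γ hγ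

theorem localClass_comp (h : IsGraphCover Γ U) {v : V} {x y z : X} (hx : x ∈ U v) (hy : y ∈ U v)
    (hz : z ∈ U v) : h.localClass v hx hy ≫ h.localClass v hy hz = h.localClass v hx hz :=
  IsSimplyConnected.pathClass_comp ..

theorem localClass_self (h : IsGraphCover Γ U) {v : V} {x : X} (hx : x ∈ U v) :
    h.localClass v hx hx = 𝟙 _ :=
  IsSimplyConnected.pathClass_self ..

theorem inv_localClass (h : IsGraphCover Γ U) {v : V} {x y : X} (hx : x ∈ U v) (hy : y ∈ U v) :
    inv (h.localClass v hx hy) = h.localClass v hy hx :=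
  IsSimplyConnected.inv_pathClass ..

theorem localClass_congr (h : IsGraphCover Γ U) {v w : V} {x y : X} (hx : x ∈ U v) (hy : y ∈ U v)
    (hx' : x ∈ U w) (hy' : y ∈ U w) : h.localClass v hx hy = h.localClass w hx' hy' := by
  by_cases hvw : v = w
  · subst hvw
    rfl
  · exact IsSimplyConnected.pathClass_eq_pathClass _ _
      (h.isPathConnected_inter (h.adj hx hx' hvw)) ⟨hx, hx'⟩ ⟨hy, hy'⟩

/-- The homotopy class of the paths from the center of `U v` to the center of `U w` that first run
in `U v` and then in `U w`. -/
noncomputable def edge (h : IsGraphCover Γ U) {v w : V} (hvw : Γ.Adj v w) :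
    FundamentalGroupoid.mk (h.center v) ⟶ FundamentalGroupoid.mk (h.center w) :=
  have hm := (h.isPathConnected_inter hvw).nonempty.some_mem
  h.localClass v (h.center_mem v) hm.1 ≫ h.localClass w hm.2 (h.center_mem w)

/-- The crossing point is irrelevant: two of them are joined inside the intersection, by a class
that may be read in `U v` or in `U w`. -/
theorem localClass_comp_localClass_eq_edge (h : IsGraphCover Γ U) {v w : V} (hvw : Γ.Adj v w) {x : X}
    (hv : x ∈ U v) (hw : x ∈ U w) :
    h.localClass v (h.center_mem v) hv ≫ h.localClass w hw (h.center_mem w) = h.edge hvw := by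
  have hm := (h.isPathConnected_inter hvw).nonempty.some_mem
  rw [edge, ← h.localClass_comp (h.center_mem v) hm.1 hv, Category.assoc,
    h.localClass_congr hm.1 hv hm.2 hw, h.localClass_comp]

theorem edge_symm (h : IsGraphCover Γ U) {v w : V} (hvw : Γ.Adj v w) :
    h.edge hvw.symm = inv (h.edge hvw) := by
  have hm := (h.isPathConnected_inter hvw).nonempty.some_mem
  rw [← h.localClass_comp_localClass_eq_edge hvw.symm hm.2 hm.1, edge, IsIso.inv_comp,
    h.inv_localClass, h.inv_localClass]

/-- A property of homotopy classes of paths that is stable under composition and holds for the paths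
in each of the sets of the cover holds for all paths. -/
theorem induction_on (h : IsGraphCover Γ U)
    {P : ∀ x y : X, (FundamentalGroupoid.mk x ⟶ FundamentalGroupoid.mk y) → Prop}
    (comp : ∀ {x y z} f g, P x y f → P y z g → P x z (f ≫ g))
    (loc : ∀ v {x y} (hx : x ∈ U v) (hy : y ∈ U v), P x y (h.localClass v hx hy))
    {x y : X} (f : FundamentalGroupoid.mk x ⟶ FundamentalGroupoid.mk y) : P x y f := by
  obtain ⟨γ, rfl⟩ := Path.Homotopic.Quotient.mk_surjective f
  -- Lebesgue number argument: each piece of the subdivision `t` stays in one set of the cover.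
  obtain ⟨t, ht0, htm, ⟨n, hn⟩, ht⟩ := exists_monotone_Icc_subset_open_cover_unitInterval
    (c := fun v => γ ⁻¹' U v) (fun v => (h.isOpen v).preimage γ.continuous)
    (fun i _ => by simpa using h.exists_mem (γ i))
  have key : ∀ k, P (γ (t 0)) (γ (t k)) (Path.Homotopic.Quotient.mk (γ.subpath (t 0) (t k))) := by
    intro k
    induction k with
    | zero =>
      obtain ⟨v, hv⟩ := h.exists_mem (γ (t 0))
      rw [Path.subpath_self]
      exact (congrArg (P _ _) (h.localClass_self hv)).mp (loc v hv hv)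
    | succ k ih =>
      obtain ⟨v, hv⟩ := ht k
      have hsub : ∀ i, γ.subpath (t k) (t (k + 1)) i ∈ U v := by
        intro i
        have : γ.subpath (t k) (t (k + 1)) i ∈ Set.range (γ.subpath (t k) (t (k + 1))) := ⟨i, rfl⟩
        rw [Path.range_subpath_of_le _ _ _ (htm k.le_succ)] at this
        obtain ⟨j, hj, hji⟩ := this
        rw [← hji]
        exact hv hj
      have hx : γ (t k) ∈ U v := hv ⟨le_rfl, htm k.le_succ⟩
      have hy : γ (t (k + 1)) ∈ U v := hv ⟨htm k.le_succ, le_rfl⟩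
      have h₁ := loc v hx hy
      rw [← h.mk_eq_localClass hx hy _ hsub] at h₁
      have h₂ := comp _ _ ih h₁
      have h₃ : Path.Homotopic.Quotient.mk (γ.subpath (t 0) (t (k + 1))) =
          (Path.Homotopic.Quotient.mk (γ.subpath (t 0) (t k))).trans
            (Path.Homotopic.Quotient.mk (γ.subpath (t k) (t (k + 1)))) := by
        rw [← Path.Homotopic.Quotient.mk_trans]
        exact (Path.Homotopic.Quotient.eq.2 ⟨Path.Homotopy.subpathTransSubpath ..⟩).symm
      rw [h₃]
      exact h₂
  have hfin := key n
  rw [ht0, hn n le_rfl] at hfin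
  have h0 : γ 0 = x := γ.source
  have h1 : γ 1 = y := γ.target
  rw [Path.subpath_zero_one] at hfin
  convert hfin using 1
  · exact h0.symm
  · exact h1.symm
  · rw [Path.Homotopic.Quotient.mk_cast]
    exact (Path.Homotopic.Quotient.cast_heq _ _).symm

end IsGraphCover

/-! ### The covering glued from a cocycle, and its monodromy -/

namespace IsGraphCover

variable {X V G : Type*} [TopologicalSpace X] {Γ : SimpleGraph V} {U : V → Set X}
  [Group G] [TopologicalSpace G] [DiscreteTopology G]

/-- The principal bundle with discrete structure group `G` over a space with a graph cover that is
glued from trivial bundles along a `G`-valued cocycle `φ`. -/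
noncomputable def bundle (h : IsGraphCover Γ U) (φ : V → V → G) (h₁ : ∀ v, φ v v = 1)
    (h₂ : ∀ v w, φ w v * φ v w = 1) : FiberBundleCore V X G where
  baseSet := U
  isOpen_baseSet := h.isOpen
  indexAt x := (h.exists_mem x).choose
  mem_baseSet_at x := (h.exists_mem x).choose_spec
  coordChange v w _ a := φ v w * a
  coordChange_self v x _ a := by rw [h₁, one_mul]
  continuousOn_coordChange v w :=
    ((continuous_of_discreteTopology (f := fun a : G => φ v w * a)).comp
      continuous_snd).continuousOn
  coordChange_comp u v w x hx a := by
    rw [← mul_assoc]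
    congr 1
    -- As no three sets meet, the cocycle condition is only needed when two of the indices agree.
    rcases h.eq_or_eq_or_eq hx.1.1 hx.1.2 hx.2 with rfl | rfl | rfl
    · rw [h₁, mul_one]
    · rw [h₁, one_mul]
    · rw [h₁, h₂]

variable (h : IsGraphCover Γ U) {φ : V → V → G} (h₁ : ∀ v, φ v v = 1)
  (h₂ : ∀ v w, φ w v * φ v w = 1)

theorem isCoveringMap_bundle : IsCoveringMap (h.bundle φ h₁ h₂).proj :=
  IsCoveringMap.mk _ (fun _ => G) (fun x => (h.bundle φ h₁ h₂).localTrivAt x)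
    fun x => (h.bundle φ h₁ h₂).mem_localTrivAt_baseSet x

/-- The point over `x` whose coordinate in the chart over `U v` is `a`. -/
noncomputable def bundlePoint (v : V) (x : X) (a : G) :
    (h.bundle φ h₁ h₂).proj ⁻¹' {x} :=
  -- The total space records the coordinate in the chart chosen at `x`, so `a` is converted from the
  -- chart `v`.
  ⟨⟨x, φ v (h.exists_mem x).choose * a⟩, rfl⟩

theorem bundlePoint_injective (v : V) (x : X) :
    Function.Injective (h.bundlePoint h₁ h₂ v x) := by
  intro a b hab
  have := congrArg (fun p => (p.1.2 : G)) hab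
  exact mul_left_cancel this

theorem bundlePoint_eq {v w : V} {x : X} (hv : x ∈ U v) (hw : x ∈ U w) (a : G) :
    h.bundlePoint h₁ h₂ v x a = h.bundlePoint h₁ h₂ w x (φ v w * a) := by
  have := (h.bundle φ h₁ h₂).coordChange_comp v w (h.exists_mem x).choose x
    ⟨⟨hv, hw⟩, (h.exists_mem x).choose_spec⟩ a
  exact Subtype.ext (congrArg (fun b : G => (⟨x, b⟩ : (h.bundle φ h₁ h₂).TotalSpace)) this.symm)

theorem continuousOn_bundlePoint (v : V) (a : G) :
    ContinuousOn (fun x => (h.bundlePoint h₁ h₂ v x a).1) (U v) := by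
  have := ((h.bundle φ h₁ h₂).localTriv v).continuousOn_invFun
  refine this.comp (f := fun x => (x, a)) (by fun_prop) fun x hx => ?_
  exact ((h.bundle φ h₁ h₂).mem_localTriv_target v (x, a)).2 hx

/-- The monodromy along `f` is the left multiplication by `g`, in the charts over `U v` and
`U w`. -/
def MonodromyEq (v w : V) {x y : X} (f : FundamentalGroupoid.mk x ⟶ FundamentalGroupoid.mk y)
    (g : G) : Prop :=
  ∀ a, (h.isCoveringMap_bundle h₁ h₂).monodromy f (h.bundlePoint h₁ h₂ v x a) =
    h.bundlePoint h₁ h₂ w y (g * a)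

variable {h h₁ h₂}

theorem MonodromyEq.comp {u v w : V} {x y z : X}
    {f : FundamentalGroupoid.mk x ⟶ FundamentalGroupoid.mk y}
    {f' : FundamentalGroupoid.mk y ⟶ FundamentalGroupoid.mk z} {g g' : G}
    (hf : h.MonodromyEq h₁ h₂ u v f g) (hf' : h.MonodromyEq h₁ h₂ v w f' g') :
    h.MonodromyEq h₁ h₂ u w (f ≫ f') (g' * g) := fun a => by
  rw [mul_assoc, ← hf', ← hf]
  exact (h.isCoveringMap_bundle h₁ h₂).monodromy_trans_apply f f' _

theorem MonodromyEq.unique {v w : V} {x y : X}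
    {f : FundamentalGroupoid.mk x ⟶ FundamentalGroupoid.mk y} {g g' : G}
    (hf : h.MonodromyEq h₁ h₂ v w f g) (hf' : h.MonodromyEq h₁ h₂ v w f g') : g = g' := by
  have := h.bundlePoint_injective h₁ h₂ w y ((hf 1).symm.trans (hf' 1))
  rwa [mul_one, mul_one] at this

theorem monodromyEq_id (v : V) (x : X) :
    h.MonodromyEq h₁ h₂ v v (𝟙 (FundamentalGroupoid.mk x)) 1 := fun a => by
  rw [one_mul]
  exact congrFun (h.isCoveringMap_bundle h₁ h₂).monodromy_refl _

theorem MonodromyEq.inv {v w : V} {x y : X}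
    {f : FundamentalGroupoid.mk x ⟶ FundamentalGroupoid.mk y} {g : G}
    (hf : h.MonodromyEq h₁ h₂ v w f g) : h.MonodromyEq h₁ h₂ w v (CategoryTheory.inv f) g⁻¹ := by
  intro a
  have h₃ := hf (g⁻¹ * a)
  rw [mul_inv_cancel_left] at h₃
  rw [← h₃]
  refine ((h.isCoveringMap_bundle h₁ h₂).monodromy_trans_apply f (CategoryTheory.inv f)
    (h.bundlePoint h₁ h₂ v x (g⁻¹ * a))).symm.trans ?_
  have h₄ : Path.Homotopic.Quotient.trans f (CategoryTheory.inv f) =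
      Path.Homotopic.Quotient.refl x := IsIso.hom_inv_id f
  rw [h₄]
  exact congrFun (h.isCoveringMap_bundle h₁ h₂).monodromy_refl _

theorem monodromyEq_localClass {v : V} {x y : X} (hx : x ∈ U v) (hy : y ∈ U v) :
    h.MonodromyEq h₁ h₂ v v (h.localClass v hx hy) 1 := by
  intro a
  rw [one_mul]
  have hJ := (h.isSimplyConnected v).isPathConnected.joinedIn x hx y hy
  have hγ := h.mk_eq_localClass hx hy hJ.somePath hJ.somePath_mem
  rw [← hγ]
  -- In the chart over `U v` the lift has the constant coordinate `a`.
  let γ' : Path (h.bundlePoint h₁ h₂ v x a).1 (h.bundlePoint h₁ h₂ v y a).1 :=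
    { toFun := fun i => (h.bundlePoint h₁ h₂ v (hJ.somePath i) a).1
      continuous_toFun := (h.continuousOn_bundlePoint h₁ h₂ v a).comp_continuous
        hJ.somePath.continuous hJ.somePath_mem
      source' := by rw [hJ.somePath.source]
      target' := by rw [hJ.somePath.target] }
  refine (h.isCoveringMap_bundle h₁ h₂).monodromy_eq_of_map_eq
    (Path.Homotopic.Quotient.mk γ') rfl

/-- Both halves of the edge have trivial monodromy in their own charts; only the change of chart at
the crossing contributes. -/
theorem monodromyEq_edge {v w : V} (hvw : Γ.Adj v w) :
    h.MonodromyEq h₁ h₂ v w (h.edge hvw) (φ v w) := by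
  have hm := (h.isPathConnected_inter hvw).nonempty.some_mem
  have H : h.MonodromyEq h₁ h₂ v w (h.localClass v (h.center_mem v) hm.1) (φ v w) := fun a => by
    rw [monodromyEq_localClass, one_mul, ← h.bundlePoint_eq h₁ h₂ hm.1 hm.2]
  have := H.comp (monodromyEq_localClass hm.2 (h.center_mem w))
  rwa [one_mul] at this

end IsGraphCover

/-! ### A cocycle with values in the free group on a set of edges -/

section OrientationCocycle

variable {V : Type*} {S : Set (Sym2 V)}

open Classical in
/-- The generator of the free group on `S` that belongs to the edge `e`, with the sign with which
`e` leaves its end `v` in a chosen orientation of the edges, and `1` if `e ∉ S`. -/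
noncomputable def orientedGenerator (S : Set (Sym2 V)) (e : Sym2 V) (v : V) : FreeGroup S :=
  if h : e ∈ S then
    if (Quot.out e).1 = v then FreeGroup.of ⟨e, h⟩ else (FreeGroup.of ⟨e, h⟩)⁻¹
  else 1

/-- The cocycle on `V` with values in the free group on `S` that takes an oriented edge in `S` to
the corresponding generator. -/
noncomputable def orientationCocycle (S : Set (Sym2 V)) (v w : V) : FreeGroup S :=
  orientedGenerator S s(v, w) v

theorem orientationCocycle_of_notMem {v w : V} (h : s(v, w) ∉ S) :
    orientationCocycle S v w = 1 := by
  simp [orientationCocycle, orientedGenerator, h]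

theorem mk_out_eq (e : Sym2 V) : s((Quot.out e).1, (Quot.out e).2) = e :=
  Quot.out_eq e

theorem orientationCocycle_out (e : S) :
    orientationCocycle S (Quot.out e.1).1 (Quot.out e.1).2 = FreeGroup.of e := by
  rw [orientationCocycle, mk_out_eq, orientedGenerator, dif_pos e.2, if_pos rfl]

theorem orientationCocycle_swap {v w : V} (hvw : v ≠ w) :
    orientationCocycle S w v = (orientationCocycle S v w)⁻¹ := by
  rw [orientationCocycle, orientationCocycle, Sym2.eq_swap]
  by_cases h : s(v, w) ∈ S
  · have h' := mk_out_eq s(v, w)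
    rw [Sym2.eq_iff] at h'
    rcases h' with h' | h'
    · simp [orientedGenerator, h, h'.1, hvw]
    · simp [orientedGenerator, h, h'.1, hvw.symm]
  · simp [orientedGenerator, h]

theorem orientationCocycle_self (hS : ∀ e ∈ S, ¬ e.IsDiag) (v : V) :
    orientationCocycle S v v = 1 :=
  orientationCocycle_of_notMem fun h => hS _ h rfl

theorem orientationCocycle_swap_mul (hS : ∀ e ∈ S, ¬ e.IsDiag) (v w : V) :
    orientationCocycle S w v * orientationCocycle S v w = 1 := by
  by_cases h : v = w
  · rw [h, orientationCocycle_self hS, one_mul]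
  · rw [orientationCocycle_swap h, inv_mul_cancel]

end OrientationCocycle

/-! ### Spanning trees given by parent functions -/

namespace SimpleGraph

variable {V : Type*} {Γ : SimpleGraph V}

/-- The function `p` takes each vertex other than `r` to its predecessor on a shortest path
from `r`. -/
def IsParent (Γ : SimpleGraph V) (r : V) (p : V → V) : Prop :=
  ∀ v, v ≠ r → Γ.Adj (p v) v ∧ Γ.dist r (p v) + 1 = Γ.dist r v

theorem Connected.exists_isParent (hΓ : Γ.Connected) (r : V) : ∃ p, Γ.IsParent r p := by
  have (v : V) : ∃ u, v ≠ r → Γ.Adj u v ∧ Γ.dist r u + 1 = Γ.dist r v := by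
    by_cases hv : v = r
    · exact ⟨v, fun h => (h hv).elim⟩
    obtain ⟨q, hq⟩ := hΓ.exists_walk_length_eq_dist v r
    cases q with
    | nil => exact (hv rfl).elim
    | @cons _ u _ huv q =>
      refine ⟨u, fun _ => ⟨huv.symm, ?_⟩⟩
      have h₁ : Γ.dist u r ≤ q.length := dist_le q
      have h₂ : Γ.dist v r ≤ Γ.dist v u + Γ.dist u r := hΓ.dist_triangle
      rw [dist_eq_one_iff_adj.2 huv] at h₂
      rw [Walk.length_cons] at hq
      rw [dist_comm (u := r), dist_comm (u := r)]
      omega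
  choose p hp using this
  exact ⟨p, hp⟩

/-- The edges of `Γ` that do not lie in the tree given by the parent function `p`. -/
def nonTreeEdges (Γ : SimpleGraph V) (r : V) (p : V → V) : Set (Sym2 V) :=
  Γ.edgeSet \ (fun v => s(p v, v)) '' {r}ᶜ

theorem not_isDiag_of_mem_nonTreeEdges {r : V} {p : V → V} (e : Sym2 V)
    (he : e ∈ Γ.nonTreeEdges r p) : ¬ e.IsDiag :=
  Γ.not_isDiag_of_mem_edgeSet he.1

/-- The tree has one edge for each vertex other than `r`. Two vertices cannot give the same edge
with its ends swapped, since each would then be farther from `r` than the other. -/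
theorem IsParent.ncard_nonTreeEdges [Finite V] {r : V} {p : V → V} (hp : Γ.IsParent r p) :
    (Γ.nonTreeEdges r p).ncard + Nat.card V = Γ.edgeSet.ncard + 1 := by
  have hinj : Set.InjOn (fun v => s(p v, v)) {r}ᶜ := by
    intro v hv w hw hvw
    rcases Sym2.eq_iff.1 hvw with h | h
    · exact h.2
    · have h₁ := (hp v hv).2
      have h₂ := (hp w hw).2
      rw [h.1] at h₁
      rw [← h.2] at h₂
      omega
  have hsub : (fun v => s(p v, v)) '' {r}ᶜ ⊆ Γ.edgeSet := by
    rintro _ ⟨v, hv, rfl⟩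
    exact (hp v hv).1
  have h₁ := Set.ncard_sdiff_add_ncard_of_subset hsub
  have h₂ := Set.ncard_add_ncard_compl ({r} : Set V)
  rw [hinj.ncard_image] at h₁
  rw [Set.ncard_singleton] at h₂
  rw [nonTreeEdges]
  omega

open Classical in
/-- The composition of the morphisms along the path from the root to `v` in the tree given by a
parent function. -/
noncomputable def IsParent.hom {C : Type*} [Category C] {r : V} {p : V → V}
    (hp : Γ.IsParent r p) (c : V → C) (ε : ∀ {v w}, Γ.Adj v w → (c v ⟶ c w)) (v : V) :
    c r ⟶ c v :=
  if h : v = r then eqToHom (by rw [h]) else hp.hom c ε (p v) ≫ ε (hp v h).1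
termination_by Γ.dist r v
decreasing_by
  have := (hp v h).2
  omega

section Hom

variable {C : Type*} [Category C] {r : V} {p : V → V} (hp : Γ.IsParent r p) (c : V → C)
  (ε : ∀ {v w}, Γ.Adj v w → (c v ⟶ c w))

theorem IsParent.hom_root : hp.hom c ε r = 𝟙 _ := by
  rw [IsParent.hom, dif_pos rfl, eqToHom_refl]

theorem IsParent.hom_of_ne {v : V} (hv : v ≠ r) :
    hp.hom c ε v = hp.hom c ε (p v) ≫ ε (hp v hv).1 := by
  rw [IsParent.hom, dif_neg hv]

end Hom

theorem IsParent.induction_on {r : V} {p : V → V} (hp : Γ.IsParent r p) {P : V → Prop}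
    (root : P r) (step : ∀ v, v ≠ r → P (p v) → P v) (v : V) : P v := by
  induction hd : Γ.dist r v using Nat.strong_induction_on generalizing v with
  | _ d ih =>
    by_cases hv : v = r
    · rwa [hv]
    · have := (hp v hv).2
      exact step v hv (ih _ (by omega) _ rfl)

end SimpleGraph

/-! ### The fundamental group of a space with a graph cover -/

namespace IsGraphCover

open SimpleGraph

variable {X V : Type*} [TopologicalSpace X] {Γ : SimpleGraph V} {U : V → Set X}
  (h : IsGraphCover Γ U) {r : V} {p : V → V} (hp : Γ.IsParent r p)

/-- The homotopy class of the paths along the tree from the center of `U r` to that of `U v`. -/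
noncomputable def treePath (v : V) :
    FundamentalGroupoid.mk (h.center r) ⟶ FundamentalGroupoid.mk (h.center v) :=
  hp.hom (fun v => FundamentalGroupoid.mk (h.center v)) h.edge v

/-- The loop that is made of the edge from `v` to `w` and of paths in the tree. -/
noncomputable def edgeLoop {v w : V} (hvw : Γ.Adj v w) : FundamentalGroup X (h.center r) :=
  h.treePath hp v ≫ h.edge hvw ≫ inv (h.treePath hp w)

theorem edgeLoop_symm {v w : V} (hvw : Γ.Adj v w) :
    h.edgeLoop hp hvw.symm = (h.edgeLoop hp hvw)⁻¹ := by
  refine eq_inv_of_mul_eq_one_left ?_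
  change (h.treePath hp v ≫ h.edge hvw ≫ inv (h.treePath hp w)) ≫
    (h.treePath hp w ≫ h.edge hvw.symm ≫ inv (h.treePath hp v)) = 𝟙 _
  simp [h.edge_symm hvw]

theorem edgeLoop_parent {v : V} (hv : v ≠ r) : h.edgeLoop hp (hp v hv).1 = 1 := by
  have := hp.hom_of_ne (fun v => FundamentalGroupoid.mk (h.center v)) h.edge hv
  rw [edgeLoop, ← Category.assoc]
  exact (congrArg (· ≫ inv (h.treePath hp v)) this.symm).trans (IsIso.hom_inv_id _)

theorem adj_out (e : Γ.nonTreeEdges r p) : Γ.Adj (Quot.out e.1).1 (Quot.out e.1).2 := by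
  have h' := mk_out_eq e.1 ▸ e.2.1
  exact h'

/-- The homomorphism from the free group on the edges outside a tree to the fundamental group. -/
noncomputable def ofFreeGroup :
    FreeGroup (Γ.nonTreeEdges r p) →* FundamentalGroup X (h.center r) :=
  FreeGroup.lift fun e => h.edgeLoop hp (adj_out e)

/-- Both sides are inverted when the edge is reversed and are trivial on tree edges, which leaves
the non-tree edges in their chosen orientation. -/
theorem ofFreeGroup_orientationCocycle {v w : V} (hvw : Γ.Adj v w) :
    h.ofFreeGroup hp (orientationCocycle _ v w) = h.edgeLoop hp hvw := by
  by_cases hS : s(v, w) ∈ Γ.nonTreeEdges r p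
  · have key {a b : V} (hab : Γ.Adj a b) (e : Γ.nonTreeEdges r p) (ha : (Quot.out e.1).1 = a)
        (hb : (Quot.out e.1).2 = b) :
        h.ofFreeGroup hp (orientationCocycle _ a b) = h.edgeLoop hp hab := by
      subst ha hb
      rw [orientationCocycle_out, ofFreeGroup, FreeGroup.lift_apply_of]
    rcases Sym2.eq_iff.1 (mk_out_eq s(v, w)) with h' | h'
    · exact key hvw ⟨_, hS⟩ h'.1 h'.2
    · have := key hvw.symm ⟨_, hS⟩ h'.1 h'.2
      rw [orientationCocycle_swap hvw.ne, map_inv, h.edgeLoop_symm hp hvw] at this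
      exact inv_injective this
  · rw [orientationCocycle_of_notMem hS, map_one]
    obtain ⟨u, hu, hus⟩ : s(v, w) ∈ (fun v => s(p v, v)) '' {r}ᶜ := by
      by_contra h'
      exact hS ⟨hvw, h'⟩
    rcases Sym2.eq_iff.1 hus with h' | h'
    · obtain ⟨rfl, rfl⟩ := h'
      exact (h.edgeLoop_parent hp hu).symm
    · obtain ⟨rfl, rfl⟩ := h'
      rw [← inv_inj, ← edgeLoop_symm, inv_one]
      exact (h.edgeLoop_parent hp hu).symm

theorem ofFreeGroup_injective : Function.Injective (h.ofFreeGroup hp) := by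
  let _ : TopologicalSpace (FreeGroup (Γ.nonTreeEdges r p)) := ⊥
  have : DiscreteTopology (FreeGroup (Γ.nonTreeEdges r p)) := ⟨rfl⟩
  have hS := fun e he => not_isDiag_of_mem_nonTreeEdges (Γ := Γ) (r := r) (p := p) e he
  have h₁ := orientationCocycle_self hS
  have h₂ := orientationCocycle_swap_mul hS
  -- The cocycle is 1 on tree edges, so tree paths have trivial monodromy.
  have htree (v : V) : h.MonodromyEq h₁ h₂ r v (h.treePath hp v) 1 := by
    induction v using hp.induction_on with
    | root =>
      rw [treePath, hp.hom_root]
      exact monodromyEq_id r _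
    | step v hv ih =>
      rw [treePath, hp.hom_of_ne _ _ hv]
      have := ih.comp (monodromyEq_edge (hp v hv).1)
      rwa [mul_one, orientationCocycle_of_notMem fun h' => h'.2 ⟨v, hv, rfl⟩] at this
  have hedge {v w : V} (hvw : Γ.Adj v w) : h.MonodromyEq h₁ h₂ r r (h.edgeLoop hp hvw)
      (orientationCocycle _ v w) := by
    have := (htree v).comp ((monodromyEq_edge hvw).comp (htree w).inv)
    rwa [inv_one, one_mul, mul_one] at this
  have hall (g : FreeGroup (Γ.nonTreeEdges r p)) :
      h.MonodromyEq h₁ h₂ r r (h.ofFreeGroup hp g) g := by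
    induction g using FreeGroup.induction_on with
    | C1 =>
      rw [map_one]
      exact monodromyEq_id r _
    | of e =>
      have := hedge (adj_out e)
      rwa [orientationCocycle_out, ← h.ofFreeGroup_orientationCocycle hp,
        orientationCocycle_out] at this
    | inv_of e ih =>
      rw [map_inv]
      have := ih.inv
      rwa [← Groupoid.inv_eq_inv] at this
    | mul x y hx hy =>
      rw [map_mul]
      -- A product in the fundamental group runs through its right factor first, as does composition
      -- of left multiplications.
      exact hy.comp hx
  intro g g' hgg'
  exact (hall g).unique (hgg' ▸ hall g')

/-- A path becomes a loop when its ends are joined to the root through charts and the tree. `P` says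
that for all choices of the two charts this loop lies in the image, so it is stable under
composition. -/
theorem ofFreeGroup_surjective : Function.Surjective (h.ofFreeGroup hp) := by
  let P (x y : X) (f : FundamentalGroupoid.mk x ⟶ FundamentalGroupoid.mk y) : Prop :=
    ∀ v w (hx : x ∈ U v) (hy : y ∈ U w), ∃ g, h.ofFreeGroup hp g =
      (h.treePath hp v ≫ h.localClass v (h.center_mem v) hx) ≫ f ≫
        h.localClass w hy (h.center_mem w) ≫ inv (h.treePath hp w)
  -- The loop that leaves through `U v` and returns through `U w` at `x` is trivial or an edge loop.
  have hU {v w : V} {x : X} (hv : x ∈ U v) (hw : x ∈ U w) : ∃ g, h.ofFreeGroup hp g =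
      h.treePath hp v ≫ h.localClass v (h.center_mem v) hv ≫
        h.localClass w hw (h.center_mem w) ≫ inv (h.treePath hp w) := by
    by_cases hvw : v = w
    · subst hvw
      refine ⟨1, (map_one _).trans ?_⟩
      rw [← Category.assoc (h.localClass v _ _), h.localClass_comp, h.localClass_self,
        Category.id_comp, IsIso.hom_inv_id]
      rfl
    · have hadj := h.adj hv hw hvw
      refine ⟨_, (h.ofFreeGroup_orientationCocycle hp hadj).trans ?_⟩
      rw [edgeLoop, ← h.localClass_comp_localClass_eq_edge hadj hv hw, Category.assoc]
  have hP {x y : X} (f : FundamentalGroupoid.mk x ⟶ FundamentalGroupoid.mk y) : P x y f := by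
    refine h.induction_on (P := P) ?_ ?_ f
    · intro x y z f f' hf hf' u w hx hz
      obtain ⟨v, hy⟩ := h.exists_mem y
      obtain ⟨g, hg⟩ := hf u v hx hy
      obtain ⟨g', hg'⟩ := hf' v w hy hz
      refine ⟨g' * g, ?_⟩
      rw [map_mul, hg, hg']
      change _ ≫ _ = _
      simp [← h.inv_localClass (h.center_mem v) hy]
    -- A path inside `U u` may be routed through the center of `U u`, which splits it into two
    -- instances of `hU`.
    · intro u x y hx hy v w hv hw
      obtain ⟨g, hg⟩ := hU hv hx
      obtain ⟨g', hg'⟩ := hU hy hw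
      refine ⟨g' * g, ?_⟩
      rw [map_mul, hg, hg', ← h.localClass_comp hx (h.center_mem u) hy]
      change _ ≫ _ = _
      simp
  intro f
  obtain ⟨g, hg⟩ := hP f r r (h.center_mem r) (h.center_mem r)
  refine ⟨g, hg.trans ?_⟩
  have : h.treePath hp r = 𝟙 _ := hp.hom_root ..
  simp [this, localClass_self]

include h

theorem pathConnectedSpace (hΓ : Γ.Connected) : PathConnectedSpace X := by
  obtain ⟨r⟩ := hΓ.nonempty
  obtain ⟨p, hp⟩ := hΓ.exists_isParent r
  have hr (x : X) : Joined (h.center r) x := by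
    obtain ⟨v, hv⟩ := h.exists_mem x
    obtain ⟨γ, -⟩ := Path.Homotopic.Quotient.mk_surjective
      (h.treePath hp v ≫ h.localClass v (h.center_mem v) hv)
    exact ⟨γ⟩
  exact ⟨⟨h.center r⟩, fun x y => (hr x).symm.trans (hr y)⟩

/-- The fundamental group of a space with a cover that is modelled on a finite connected graph is
free of rank `e - v + 1`. -/
theorem nonempty_fundamentalGroup_mulEquiv [Finite V] (hΓ : Γ.Connected) {n : ℕ}
    (hn : n + Nat.card V = Γ.edgeSet.ncard + 1) (x : X) :
    Nonempty (FundamentalGroup X x ≃* FreeGroup (Fin n)) := by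
  have := h.pathConnectedSpace hΓ
  obtain ⟨r⟩ := hΓ.nonempty
  obtain ⟨p, hp⟩ := hΓ.exists_isParent r
  have hS := hp.ncard_nonTreeEdges
  have e : Γ.nonTreeEdges r p ≃ Fin n :=
    (Finite.equivFin _).trans (finCongr (by rw [Nat.card_coe_set_eq]; omega))
  exact ⟨((FundamentalGroup.fundamentalGroupMulEquivOfPathConnected x (h.center r)).trans
    (MulEquiv.ofBijective (h.ofFreeGroup hp)
      ⟨h.ofFreeGroup_injective hp, h.ofFreeGroup_surjective hp⟩).symm).trans
    (FreeGroup.freeGroupCongr e)⟩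

end IsGraphCover

/-! ### Cells of `Hom(K_n, K_{n+1})` and the injection graph -/

namespace HomCell

variable {n : ℕ}

theorem sum_card_eq_dim_add {V W : Type*} [Fintype V] {G : SimpleGraph V} {H : SimpleGraph W}
    (η : HomCell G H) : ∑ v, (η.color v).card = η.dim + Fintype.card V := by
  rw [dim, Fintype.card_eq_sum_ones, ← Finset.sum_add_distrib]
  exact Finset.sum_congr rfl fun v _ => (Nat.sub_add_cancel (η.nonempty v).card_pos).symm

theorem dim_le_one (η : HomCell (completeGraphK n) (completeGraphK (n + 1))) : η.dim ≤ 1 := by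
  have h₁ := η.sum_card_eq_dim_add
  have h₂ : (Finset.univ.biUnion η.color).card = ∑ v, (η.color v).card := by
    refine Finset.card_biUnion fun i _ j _ hij => Finset.disjoint_left.2 fun a hi hj => ?_
    exact η.adj i j hij a hi a hj rfl
  have h₃ := (Finset.univ.biUnion η.color).card_le_univ
  rw [Fintype.card_fin] at h₁ h₃
  omega

theorem card_color_eq_one_of_ne (η : HomCell (completeGraphK n) (completeGraphK (n + 1)))
    {i j : Fin n} (hi : 1 < (η.color i).card) (hij : j ≠ i) : (η.color j).card = 1 := by
  have h₁ := η.dim_le_one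
  have h₂ : ∑ k ∈ {i, j}, ((η.color k).card - 1) ≤ η.dim :=
    Finset.sum_le_sum_of_subset (Finset.subset_univ _)
  rw [Finset.sum_pair hij.symm] at h₂
  have := (η.nonempty j).card_pos
  omega

theorem card_color_le_two (η : HomCell (completeGraphK n) (completeGraphK (n + 1)))
    (i : Fin n) : (η.color i).card ≤ 2 := by
  have h₁ := η.dim_le_one
  have h₂ : ∑ k ∈ {i}, ((η.color k).card - 1) ≤ η.dim :=
    Finset.sum_le_sum_of_subset (Finset.subset_univ _)
  rw [Finset.sum_singleton] at h₂
  omega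

end HomCell

/-- The graph whose vertices are the injections of an `n`-element set into a set with `n + 1`
elements; two injections are adjacent if they differ at exactly one element. -/
def injectionGraph (n : ℕ) : SimpleGraph (Fin n ↪ Fin (n + 1)) where
  Adj σ τ := ∃ i, σ i ≠ τ i ∧ ∀ j, j ≠ i → σ j = τ j
  symm := ⟨fun _ _ ⟨i, hi, h⟩ => ⟨i, hi.symm, fun j hj => (h j hj).symm⟩⟩
  loopless := ⟨fun _ ⟨_, hi, _⟩ => hi rfl⟩

namespace HomCell

variable {n : ℕ}

/-- The injection `σ` is a vertex of the cell `η`. -/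
def IsVertex (η : HomCell (completeGraphK n) (completeGraphK (n + 1)))
    (σ : Fin n ↪ Fin (n + 1)) : Prop :=
  ∀ i, σ i ∈ η.color i

variable {η : HomCell (completeGraphK n) (completeGraphK (n + 1))} {ρ σ τ : Fin n ↪ Fin (n + 1)}

theorem IsVertex.adj (hσ : η.IsVertex σ) (hτ : η.IsVertex τ) (h : σ ≠ τ) :
    (injectionGraph n).Adj σ τ := by
  obtain ⟨i, hi⟩ := DFunLike.ne_iff.1 h
  refine ⟨i, hi, fun j hj => ?_⟩
  have h₁ : 1 < (η.color i).card := Finset.one_lt_card.2 ⟨_, hσ i, _, hτ i, hi⟩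
  exact Finset.card_le_one.1 (η.card_color_eq_one_of_ne h₁ hj).le _ (hσ j) _ (hτ j)

theorem IsVertex.color_eq (hσ : η.IsVertex σ) (hτ : η.IsVertex τ) (h : σ ≠ τ) (j : Fin n) :
    η.color j = {σ j, τ j} := by
  obtain ⟨i, hi, h⟩ := hσ.adj hτ h
  have h₁ : 1 < (η.color i).card := Finset.one_lt_card.2 ⟨_, hσ i, _, hτ i, hi⟩
  have hsub : {σ j, τ j} ⊆ η.color j := by
    simp [Finset.insert_subset_iff, hσ j, hτ j]
  refine (Finset.eq_of_subset_of_card_le hsub ?_).symm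
  by_cases hj : j = i
  · subst hj
    rw [Finset.card_pair hi]
    exact η.card_color_le_two j
  · rw [η.card_color_eq_one_of_ne h₁ hj]
    exact Finset.card_pos.2 ⟨_, Finset.mem_insert_self _ _⟩

/-- Where `σ` and `τ` agree, `ρ` has no choice; at the one place where they differ, it follows one
of them. -/
theorem IsVertex.eq_or_eq_or_eq (hρ : η.IsVertex ρ) (hσ : η.IsVertex σ) (hτ : η.IsVertex τ) :
    ρ = σ ∨ σ = τ ∨ ρ = τ := by
  by_cases h : σ = τ
  · exact .inr (.inl h)
  obtain ⟨i, hi, h'⟩ := hσ.adj hτ h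
  have key (j) : ρ j = σ j ∨ ρ j = τ j := by
    simpa [hσ.color_eq hτ h] using hρ j
  rcases key i with hi' | hi'
  · refine .inl (DFunLike.ext _ _ fun j => ?_)
    by_cases hj : j = i
    · rwa [hj]
    · simpa [h' j hj] using key j
  · refine .inr (.inr (DFunLike.ext _ _ fun j => ?_))
    by_cases hj : j = i
    · rwa [hj]
    · simpa [h' j hj] using key j

theorem exists_vertex_apply_eq (η : HomCell (completeGraphK n) (completeGraphK (n + 1)))
    {i : Fin n} {a : Fin (n + 1)} (ha : a ∈ η.color i) : ∃ σ, η.IsVertex σ ∧ σ i = a := by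
  classical
  let f : Fin n → Fin (n + 1) := fun j => if j = i then a else (η.nonempty j).choose
  have hf (j) : f j ∈ η.color j := by
    by_cases hj : j = i
    · subst hj
      simpa [f] using ha
    · simpa [f, hj] using (η.nonempty j).choose_spec
  refine ⟨⟨f, fun j k hjk => ?_⟩, hf, by simp [f]⟩
  by_contra h
  exact η.adj j k h _ (hf j) _ (hf k) hjk

theorem exists_vertex (η : HomCell (completeGraphK n) (completeGraphK (n + 1))) :
    ∃ σ, η.IsVertex σ := by
  choose f hf using η.nonempty
  refine ⟨⟨f, fun j k hjk => ?_⟩, hf⟩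
  by_contra h
  exact η.adj j k h _ (hf j) _ (hf k) hjk

end HomCell

/-- At least one of `i` and `j` is a place where `σ` and `τ` agree. This makes the union of two
adjacent vertices a cell. -/
theorem injectionGraph_ne_of_ne {n : ℕ} {σ τ : Fin n ↪ Fin (n + 1)}
    (h : (injectionGraph n).Adj σ τ) {i j : Fin n} (hij : i ≠ j) : σ i ≠ τ j := by
  obtain ⟨k, hk, h⟩ := h
  by_cases hi : i = k
  · rw [← h j (hi ▸ hij.symm)]
    exact σ.injective.ne hij
  · rw [h i hi]
    exact τ.injective.ne hij

/-- The vertex of the complex that is given by an injection. -/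
def vertexCell {n : ℕ} (σ : Fin n ↪ Fin (n + 1)) :
    HomCell (completeGraphK n) (completeGraphK (n + 1)) where
  color i := {σ i}
  nonempty i := Finset.singleton_nonempty _
  adj i j hij a ha b hb := by
    rw [Finset.mem_singleton] at ha hb
    rw [ha, hb]
    exact σ.injective.ne hij

/-- The edge of the complex that joins two adjacent vertices. -/
def edgeCell {n : ℕ} {σ τ : Fin n ↪ Fin (n + 1)} (h : (injectionGraph n).Adj σ τ) :
    HomCell (completeGraphK n) (completeGraphK (n + 1)) where
  color i := {σ i, τ i}
  nonempty i := Finset.insert_nonempty _ _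
  adj i j hij a ha b hb := by
    rw [Finset.mem_insert, Finset.mem_singleton] at ha hb
    rcases ha with rfl | rfl <;> rcases hb with rfl | rfl
    · exact σ.injective.ne hij
    · exact injectionGraph_ne_of_ne h hij
    · exact (injectionGraph_ne_of_ne h hij.symm).symm
    · exact τ.injective.ne hij

/-! ### Cells of dimension zero and one as vertices and edges -/

section Cells

variable {n : ℕ}

theorem dim_vertexCell (σ : Fin n ↪ Fin (n + 1)) : (vertexCell σ).dim = 0 := by
  simp [HomCell.dim, vertexCell]

theorem dim_edgeCell {σ τ : Fin n ↪ Fin (n + 1)} (h : (injectionGraph n).Adj σ τ) :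
    (edgeCell h).dim = 1 := by
  have h' := h
  obtain ⟨i, hi, h'⟩ := h'
  rw [HomCell.dim, Finset.sum_eq_single i]
  · simp [edgeCell, Finset.card_pair hi]
  · intro j _ hj
    simp [edgeCell, h' j hj]
  · simp

theorem vertexCell_injective : Function.Injective (vertexCell (n := n)) := by
  intro σ τ h
  refine DFunLike.ext _ _ fun i => ?_
  simpa [vertexCell] using congrArg (fun η => η.color i) h

theorem eq_vertexCell {η : HomCell (completeGraphK n) (completeGraphK (n + 1))}
    (hη : η.dim = 0) {σ : Fin n ↪ Fin (n + 1)} (hσ : η.IsVertex σ) : η = vertexCell σ := by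
  ext1
  funext i
  have h₁ := (Finset.sum_eq_zero_iff.1 hη) i (Finset.mem_univ i)
  exact (Finset.eq_of_subset_of_card_le (Finset.singleton_subset_iff.2 (hσ i))
    (by rw [Finset.card_singleton]; omega)).symm

theorem isFace_vertexCell_iff {η : HomCell (completeGraphK n) (completeGraphK (n + 1))}
    {σ : Fin n ↪ Fin (n + 1)} : (vertexCell σ).IsFace η ↔ η.IsVertex σ := by
  simp [HomCell.IsFace, HomCell.IsVertex, vertexCell]

theorem card_embedding_fin_succ :
    Fintype.card (Fin n ↪ Fin (n + 1)) = Nat.factorial (n + 1) := by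
  have := Nat.factorial_mul_descFactorial n.le_succ
  rw [Nat.succ_eq_add_one, Nat.add_sub_cancel_left, Nat.factorial_one, one_mul] at this
  rw [Fintype.card_embedding_eq, Fintype.card_fin, Fintype.card_fin, this]

theorem ncard_dim_eq_zero :
    {σ : HomCell (completeGraphK n) (completeGraphK (n + 1)) | σ.dim = 0}.ncard =
      Nat.factorial (n + 1) := by
  have : {σ : HomCell (completeGraphK n) (completeGraphK (n + 1)) | σ.dim = 0} =
      vertexCell '' Set.univ := by
    ext η
    constructor
    · intro hη
      obtain ⟨σ, hσ⟩ := η.exists_vertex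
      exact ⟨σ, trivial, (eq_vertexCell hη hσ).symm⟩
    · rintro ⟨σ, -, rfl⟩
      exact dim_vertexCell σ
  rw [this, Set.ncard_image_of_injective _ vertexCell_injective, Set.ncard_univ,
    Nat.card_eq_fintype_card, card_embedding_fin_succ]

theorem exists_edge {η : HomCell (completeGraphK n) (completeGraphK (n + 1))} (hη : η.dim = 1) :
    ∃ e ∈ (injectionGraph n).edgeSet, ∀ σ, σ ∈ e ↔ η.IsVertex σ := by
  obtain ⟨i, -, hi⟩ := Finset.exists_ne_zero_of_sum_ne_zero (hη.trans_ne one_ne_zero)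
  obtain ⟨a, ha, b, hb, hab⟩ := Finset.one_lt_card.1 (show 1 < (η.color i).card by omega)
  obtain ⟨σ, hσ, rfl⟩ := η.exists_vertex_apply_eq ha
  obtain ⟨τ, hτ, rfl⟩ := η.exists_vertex_apply_eq hb
  have hστ : σ ≠ τ := fun h => hab (by rw [h])
  refine ⟨s(σ, τ), hσ.adj hτ hστ, fun ρ => ?_⟩
  rw [Sym2.mem_iff]
  constructor
  · rintro (rfl | rfl) <;> assumption
  · intro hρ
    rcases hρ.eq_or_eq_or_eq hσ hτ with h | h | h
    · exact .inl h
    · exact (hστ h).elim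
    · exact .inr h

/-- The edge of the injection graph whose ends are the vertices of a cell of dimension one. -/
noncomputable def cellEdge (η : {η : HomCell (completeGraphK n) (completeGraphK (n + 1)) |
    η.dim = 1}) : Sym2 (Fin n ↪ Fin (n + 1)) :=
  (exists_edge η.2).choose

theorem cellEdge_mem_edgeSet (η : {η : HomCell (completeGraphK n) (completeGraphK (n + 1)) |
    η.dim = 1}) : cellEdge η ∈ (injectionGraph n).edgeSet :=
  (exists_edge η.2).choose_spec.1

theorem mem_cellEdge (η : {η : HomCell (completeGraphK n) (completeGraphK (n + 1)) |
    η.dim = 1}) (σ : Fin n ↪ Fin (n + 1)) : σ ∈ cellEdge η ↔ η.1.IsVertex σ :=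
  (exists_edge η.2).choose_spec.2 σ

/-- Every colour of a cell is a value of one of its vertices, so the vertices determine the cell. -/
theorem cellEdge_injective : Function.Injective (cellEdge (n := n)) := by
  intro η η' h
  have hiff (σ) : η.1.IsVertex σ ↔ η'.1.IsVertex σ := by
    rw [← mem_cellEdge, ← mem_cellEdge, h]
  refine Subtype.ext (HomCell.ext (funext fun i => Finset.ext fun a => ?_))
  constructor
  · intro ha
    obtain ⟨σ, hσ, rfl⟩ := η.1.exists_vertex_apply_eq ha
    exact (hiff σ).1 hσ i
  · intro ha
    obtain ⟨σ, hσ, rfl⟩ := η'.1.exists_vertex_apply_eq ha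
    exact (hiff σ).2 hσ i

theorem exists_cellEdge_eq {e : Sym2 (Fin n ↪ Fin (n + 1))}
    (he : e ∈ (injectionGraph n).edgeSet) : ∃ η, cellEdge η = e := by
  induction e with
  | h σ τ =>
    refine ⟨⟨edgeCell he, dim_edgeCell he⟩, ?_⟩
    have hne : σ ≠ τ := (injectionGraph n).ne_of_adj he
    refine ((Sym2.mem_and_mem_iff hne).1 ⟨?_, ?_⟩)
    · exact (mem_cellEdge _ _).2 fun i => Finset.mem_insert_self _ _
    · exact (mem_cellEdge _ _).2 fun i =>
        Finset.mem_insert_of_mem (Finset.mem_singleton_self _)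

theorem ncard_dim_eq_one :
    {η : HomCell (completeGraphK n) (completeGraphK (n + 1)) | η.dim = 1}.ncard =
      (injectionGraph n).edgeSet.ncard := by
  rw [← Nat.card_coe_set_eq, ← Set.ncard_univ, ← Set.ncard_image_of_injective _ cellEdge_injective]
  congr 1
  ext e
  constructor
  · rintro ⟨η, -, rfl⟩
    exact cellEdge_mem_edgeSet η
  · intro he
    obtain ⟨η, hη⟩ := exists_cellEdge_eq he
    exact ⟨η, trivial, hη⟩

theorem ncard_edges_at_eq (σ : Fin n ↪ Fin (n + 1)) :
    {η : HomCell (completeGraphK n) (completeGraphK (n + 1)) |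
      η.dim = 1 ∧ (vertexCell σ).IsFace η}.ncard = ((injectionGraph n).incidenceSet σ).ncard := by
  have h₁ : {η : HomCell (completeGraphK n) (completeGraphK (n + 1)) |
      η.dim = 1 ∧ (vertexCell σ).IsFace η} =
      Subtype.val '' {η : {η : HomCell (completeGraphK n) (completeGraphK (n + 1)) |
        η.dim = 1} | σ ∈ cellEdge η} := by
    ext η
    constructor
    · rintro ⟨hη, hσ⟩
      exact ⟨⟨η, hη⟩, (mem_cellEdge _ σ).2 (isFace_vertexCell_iff.1 hσ), rfl⟩
    · rintro ⟨η, hσ, rfl⟩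
      exact ⟨η.2, isFace_vertexCell_iff.2 ((mem_cellEdge _ σ).1 hσ)⟩
  rw [h₁, Set.ncard_image_of_injective _ Subtype.val_injective,
    ← Set.ncard_image_of_injective _ cellEdge_injective]
  congr 1
  ext e
  constructor
  · rintro ⟨η, hη, rfl⟩
    exact ⟨cellEdge_mem_edgeSet η, hη⟩
  · rintro ⟨he, hσ⟩
    obtain ⟨η, rfl⟩ := exists_cellEdge_eq he
    exact ⟨η, hσ, rfl⟩

/-! ### Degrees, number of edges and connectedness -/

/-- There is exactly one value that the injection `σ` does not take. -/
theorem exists_notMem_range_iff (σ : Fin n ↪ Fin (n + 1)) :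
    ∃ m, ∀ a, a ∉ Set.range σ ↔ a = m := by
  have h := Set.ncard_add_ncard_compl (Set.range σ)
  rw [← Set.image_univ, Set.ncard_image_of_injective _ σ.injective] at h
  simp only [Set.ncard_univ, Nat.card_eq_fintype_card, Fintype.card_fin] at h
  obtain ⟨m, hm⟩ := Set.ncard_eq_one.1 (show (σ '' Set.univ)ᶜ.ncard = 1 by omega)
  refine ⟨m, fun a => ?_⟩
  rw [← Set.image_univ, ← Set.mem_compl_iff, hm, Set.mem_singleton_iff]

/-- The injection that is obtained from `σ` by changing its value at `i` to a value that it does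
not take. -/
def moveTo (σ : Fin n ↪ Fin (n + 1)) (i : Fin n) {m : Fin (n + 1)} (hm : m ∉ Set.range σ) :
    Fin n ↪ Fin (n + 1) where
  toFun := Function.update σ i m
  inj' j k hjk := by
    have h (l : Fin n) : σ l ≠ m := fun h => hm ⟨l, h⟩
    by_cases hj : j = i <;> by_cases hk : k = i
    · rw [hj, hk]
    · subst hj
      simp [hk, (h k).symm] at hjk
    · subst hk
      simp [hj, h j] at hjk
    · simpa [hj, hk] using hjk

theorem moveTo_self (σ : Fin n ↪ Fin (n + 1)) (i : Fin n) {m : Fin (n + 1)}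
    (hm : m ∉ Set.range σ) : moveTo σ i hm i = m :=
  Function.update_self ..

theorem moveTo_of_ne (σ : Fin n ↪ Fin (n + 1)) {i j : Fin n} {m : Fin (n + 1)}
    (hm : m ∉ Set.range σ) (h : j ≠ i) : moveTo σ i hm j = σ j :=
  Function.update_of_ne h ..

theorem adj_moveTo (σ : Fin n ↪ Fin (n + 1)) (i : Fin n) {m : Fin (n + 1)}
    (hm : m ∉ Set.range σ) : (injectionGraph n).Adj σ (moveTo σ i hm) :=
  ⟨i, by rw [moveTo_self]; exact fun h => hm ⟨i, h⟩, fun j hj => (moveTo_of_ne σ hm hj).symm⟩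

theorem ncard_neighborSet (σ : Fin n ↪ Fin (n + 1)) :
    ((injectionGraph n).neighborSet σ).ncard = n := by
  obtain ⟨m, hm⟩ := exists_notMem_range_iff σ
  have hmσ := (hm m).2 rfl
  have h : (injectionGraph n).neighborSet σ = (fun i => moveTo σ i hmσ) '' Set.univ := by
    ext τ
    constructor
    · intro hτ
      obtain ⟨i, hi, hij⟩ := id hτ
      refine ⟨i, trivial, DFunLike.ext _ _ fun j => ?_⟩
      by_cases hj : j = i
      · subst hj
        rw [moveTo_self, eq_comm, ← hm]
        rintro ⟨k, hk⟩
        by_cases hkj : k = j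
        · exact hi (hkj ▸ hk)
        · exact injectionGraph_ne_of_ne hτ hkj hk
      · rw [moveTo_of_ne _ _ hj, hij j hj]
    · rintro ⟨i, -, rfl⟩
      exact adj_moveTo σ i hmσ
  have hinj : Function.Injective fun i => moveTo σ i hmσ := by
    intro i j hij
    by_contra hne
    have := DFunLike.congr_fun hij i
    rw [moveTo_self, moveTo_of_ne _ _ hne] at this
    exact hmσ ⟨i, this.symm⟩
  rw [h, Set.ncard_image_of_injective _ hinj, Set.ncard_univ, Nat.card_eq_fintype_card,
    Fintype.card_fin]

theorem ncard_incidenceSet (σ : Fin n ↪ Fin (n + 1)) :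
    ((injectionGraph n).incidenceSet σ).ncard = n := by
  classical
  rw [← Nat.card_coe_set_eq, Nat.card_congr ((injectionGraph n).incidenceSetEquivNeighborSet σ),
    Nat.card_coe_set_eq, ncard_neighborSet]

theorem two_mul_ncard_edgeSet :
    2 * (injectionGraph n).edgeSet.ncard = n * Nat.factorial (n + 1) := by
  classical
  have h := (injectionGraph n).sum_degrees_eq_twice_card_edges
  have hdeg (σ) : (injectionGraph n).degree σ = n := by
    rw [← SimpleGraph.card_neighborSet_eq_degree, ← Nat.card_eq_fintype_card, Nat.card_coe_set_eq,
      ncard_neighborSet]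
  simp only [hdeg, Finset.sum_const, Finset.card_univ, card_embedding_fin_succ,
    smul_eq_mul] at h
  rw [← SimpleGraph.coe_edgeFinset, Set.ncard_coe_finset, ← h, mul_comm]

theorem reachable_castSuccEmb (σ : Fin n ↪ Fin (n + 1)) :
    (injectionGraph n).Reachable σ Fin.castSuccEmb := by
  classical
  -- The measure is twice the number of misplaced places, plus 1 if the missing value is `Fin.last
  -- n`. In that case a misplaced place moves to `Fin.last n` and the 1 disappears. Otherwise the
  -- missing value is the target of a misplaced place, which moves there; the gain of 2 outweighs a
  -- possible new 1.
  induction hN : 2 * (Finset.univ.filter fun i => σ i ≠ i.castSucc).card +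
    (if Fin.last n ∈ Set.range σ then 0 else 1) using Nat.strong_induction_on
    generalizing σ with
  | _ N ih =>
    by_cases hσ : σ = Fin.castSuccEmb
    · rw [hσ]
    obtain ⟨m, hm⟩ := exists_notMem_range_iff σ
    have hmσ := (hm m).2 rfl
    suffices ∃ i, 2 * (Finset.univ.filter fun j => moveTo σ i hmσ j ≠ j.castSucc).card +
        (if Fin.last n ∈ Set.range (moveTo σ i hmσ) then 0 else 1) < N by
      obtain ⟨i, hi⟩ := this
      exact (adj_moveTo σ i hmσ).reachable.trans (ih _ hi _ rfl)
    by_cases hlast : m = Fin.last n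
    · obtain ⟨i, hi⟩ := DFunLike.ne_iff.1 hσ
      refine ⟨i, ?_⟩
      have h₁ : (Finset.univ.filter fun j => moveTo σ i hmσ j ≠ j.castSucc).card ≤
          (Finset.univ.filter fun i => σ i ≠ i.castSucc).card := by
        refine Finset.card_le_card fun j => ?_
        by_cases hj : j = i
        · subst hj
          intro _
          simpa using hi
        · simp [moveTo_of_ne _ _ hj]
      rw [if_neg (hlast ▸ hmσ)] at hN
      rw [if_pos ⟨i, (moveTo_self ..).trans hlast⟩]
      omega
    · obtain ⟨i, rfl⟩ := Fin.exists_castSucc_eq.2 hlast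
      refine ⟨i, ?_⟩
      have h₁ : (Finset.univ.filter fun j => moveTo σ i hmσ j ≠ j.castSucc).card <
          (Finset.univ.filter fun i => σ i ≠ i.castSucc).card := by
        refine Finset.card_lt_card ((Finset.ssubset_iff_of_subset fun j => ?_).2 ⟨i, ?_, ?_⟩)
        · by_cases hj : j = i
          · subst hj
            simp [moveTo_self]
          · simp [moveTo_of_ne _ _ hj]
        · simpa using fun h => hmσ ⟨i, h⟩
        · simp [moveTo_self]
      split_ifs at hN ⊢ <;> omega

theorem connected_injectionGraph : (injectionGraph n).Connected :=
  { preconnected := fun σ τ => (reachable_castSuccEmb σ).trans (reachable_castSuccEmb τ).symm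
    nonempty := ⟨Fin.castSuccEmb⟩ }

end Cells

/-! ### Open stars of the vertices -/

section OpenStar

variable {n : ℕ}

open Classical in
/-- The cell whose vertices are given by the nonzero coordinates of `t`. -/
noncomputable def supportCell {t : Fin n → Fin (n + 1) → ℝ}
    (h₁ : ∀ i, t i ∈ stdSimplex ℝ (Fin (n + 1)))
    (h₂ : ∀ i j, i ≠ j → ∀ a, t i a ≠ 0 → t j a = 0) :
    HomCell (completeGraphK n) (completeGraphK (n + 1)) where
  color i := Finset.univ.filter fun a => t i a ≠ 0
  nonempty i := by
    obtain ⟨a, -, ha⟩ := Finset.exists_ne_zero_of_sum_ne_zero ((h₁ i).2.trans_ne one_ne_zero)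
    exact ⟨a, by simpa using ha⟩
  adj i j hij a ha b hb := by
    rintro rfl
    simp only [Finset.mem_filter_univ] at ha hb
    exact hb (h₂ i j hij a ha)

theorem mem_color_supportCell {t : Fin n → Fin (n + 1) → ℝ}
    (h₁ : ∀ i, t i ∈ stdSimplex ℝ (Fin (n + 1)))
    (h₂ : ∀ i j, i ≠ j → ∀ a, t i a ≠ 0 → t j a = 0) (i : Fin n) (a : Fin (n + 1)) :
    a ∈ (supportCell h₁ h₂).color i ↔ t i a ≠ 0 := by
  simp [supportCell]

/-- The supports of the rows of `t` form a cell exactly when they are pairwise disjoint. -/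
theorem mem_homComplex_iff {t : Fin n → Fin (n + 1) → ℝ} :
    t ∈ homComplex (completeGraphK n) (completeGraphK (n + 1)) ↔
      (∀ i, t i ∈ stdSimplex ℝ (Fin (n + 1))) ∧
        ∀ i j, i ≠ j → ∀ a, t i a ≠ 0 → t j a = 0 := by
  rw [homComplex, Set.mem_iUnion]
  constructor
  · rintro ⟨η, hη⟩
    refine ⟨fun i => (hη i).1, fun i j hij a ha => (hη j).2 a fun hj => ?_⟩
    have hi : a ∈ η.color i := by
      by_contra hi
      exact ha ((hη i).2 a hi)
    exact η.adj i j hij a hi a hj rfl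
  · rintro ⟨h₁, h₂⟩
    refine ⟨supportCell h₁ h₂, fun i => ⟨h₁ i, fun a ha => ?_⟩⟩
    rwa [mem_color_supportCell, not_not] at ha

/-- The open star of the vertex given by `σ`. -/
def openStar (σ : Fin n ↪ Fin (n + 1)) : Set (Fin n → Fin (n + 1) → ℝ) :=
  {t | t ∈ homComplex (completeGraphK n) (completeGraphK (n + 1)) ∧ ∀ i, 0 < t i (σ i)}

/-- For the support cell of `t`, this turns statements on the stars that contain `t` into statements
on the vertices of one cell. -/
theorem exists_isVertex_iff {t : Fin n → Fin (n + 1) → ℝ}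
    (ht : t ∈ homComplex (completeGraphK n) (completeGraphK (n + 1))) :
    ∃ η : HomCell (completeGraphK n) (completeGraphK (n + 1)),
      (∀ i a, a ∈ η.color i ↔ t i a ≠ 0) ∧ ∀ σ, η.IsVertex σ ↔ t ∈ openStar σ := by
  obtain ⟨h₁, h₂⟩ := mem_homComplex_iff.1 ht
  refine ⟨supportCell h₁ h₂, mem_color_supportCell h₁ h₂, fun σ => ?_⟩
  simp only [HomCell.IsVertex, mem_color_supportCell]
  exact ⟨fun h => ⟨ht, fun i => ((h₁ i).1 _).lt_of_ne (h i).symm⟩, fun h i => (h.2 i).ne'⟩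

theorem segment_subset_homComplex {s t : Fin n → Fin (n + 1) → ℝ}
    (hs : s ∈ homComplex (completeGraphK n) (completeGraphK (n + 1)))
    (ht : t ∈ homComplex (completeGraphK n) (completeGraphK (n + 1)))
    (hst : ∀ i j, i ≠ j → ∀ a, s i a ≠ 0 → t j a = 0) :
    segment ℝ s t ⊆ homComplex (completeGraphK n) (completeGraphK (n + 1)) := by
  rintro _ ⟨c, d, hc, hd, hcd, rfl⟩
  rw [mem_homComplex_iff] at hs ht ⊢
  refine ⟨fun i => convex_stdSimplex ℝ _ (hs.1 i) (ht.1 i) hc hd hcd, fun i j hij a ha => ?_⟩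
  have key : s j a = 0 ∧ t j a = 0 := by
    by_cases hsi : s i a = 0
    · have hti : t i a ≠ 0 := fun hti => ha (by simp [hsi, hti])
      refine ⟨?_, ht.2 i j hij a hti⟩
      by_contra hsj
      exact hti (hst j i hij.symm a hsj)
    · exact ⟨hs.2 i j hij a hsi, hst i j hij a hsi⟩
  simp [key]

theorem segment_subset_openStar {σ : Fin n ↪ Fin (n + 1)} {s t : Fin n → Fin (n + 1) → ℝ}
    (hs : s ∈ openStar σ) (ht : t ∈ openStar σ)
    (hst : ∀ i j, i ≠ j → ∀ a, s i a ≠ 0 → t j a = 0) : segment ℝ s t ⊆ openStar σ := by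
  intro u hu
  refine ⟨segment_subset_homComplex hs.1 ht.1 hst hu, fun i => ?_⟩
  obtain ⟨c, d, hc, hd, hcd, rfl⟩ := hu
  exact convex_Ioi (0 : ℝ) (hs.2 i) (ht.2 i) hc hd hcd

/-- The vertex of the complex that is given by `σ`, as a point. -/
def vertexPoint (σ : Fin n ↪ Fin (n + 1)) : Fin n → Fin (n + 1) → ℝ :=
  fun i => Pi.single (σ i) 1

theorem eq_of_vertexPoint_ne_zero {σ : Fin n ↪ Fin (n + 1)} {i : Fin n} {a : Fin (n + 1)}
    (h : vertexPoint σ i a ≠ 0) : a = σ i := by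
  by_contra ha
  exact h (Pi.single_eq_of_ne ha _)

theorem vertexPoint_mem_openStar (σ : Fin n ↪ Fin (n + 1)) : vertexPoint σ ∈ openStar σ := by
  refine ⟨mem_homComplex_iff.2 ⟨fun i => single_mem_stdSimplex ℝ (σ i), fun i j hij a ha => ?_⟩,
    fun i => by simp [vertexPoint]⟩
  rw [eq_of_vertexPoint_ne_zero ha]
  exact Pi.single_eq_of_ne (σ.injective.ne hij) _

theorem starConvex_openStar (σ : Fin n ↪ Fin (n + 1)) :
    StarConvex ℝ (vertexPoint σ) (openStar σ) := by
  rw [starConvex_iff_segment_subset]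
  intro t ht
  refine segment_subset_openStar (vertexPoint_mem_openStar σ) ht fun i j hij a ha => ?_
  rw [eq_of_vertexPoint_ne_zero ha]
  exact (mem_homComplex_iff.1 ht.1).2 i j hij _ (ht.2 i).ne'

theorem isSimplyConnected_openStar (σ : Fin n ↪ Fin (n + 1)) :
    IsSimplyConnected (openStar σ) := by
  have := (starConvex_openStar σ).contractibleSpace ⟨_, vertexPoint_mem_openStar σ⟩
  exact SimplyConnectedSpace.ofContractible _

theorem isPathConnected_openStar_inter {σ τ : Fin n ↪ Fin (n + 1)}
    (h : (injectionGraph n).Adj σ τ) : IsPathConnected (openStar σ ∩ openStar τ) := by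
  have hσ := vertexPoint_mem_openStar σ
  have hτ := vertexPoint_mem_openStar τ
  have hconv : Convex ℝ (openStar σ ∩ openStar τ) := by
    rw [convex_iff_segment_subset]
    intro s hs t ht
    -- A point in both stars has support `{σ i, τ i}` in row `i`, and `t` uses both of these values
    -- in row `i`, hence not in row `j`.
    have hst : ∀ i j, i ≠ j → ∀ a, s i a ≠ 0 → t j a = 0 := by
      intro i j hij a ha
      obtain ⟨η, hη, hηv⟩ := exists_isVertex_iff hs.1.1
      rw [← hη, ((hηv σ).2 hs.1).color_eq ((hηv τ).2 hs.2) h.ne, Finset.mem_insert,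
        Finset.mem_singleton] at ha
      rcases ha with rfl | rfl
      · exact (mem_homComplex_iff.1 ht.1.1).2 i j hij _ (ht.1.2 i).ne'
      · exact (mem_homComplex_iff.1 ht.1.1).2 i j hij _ (ht.2.2 i).ne'
    exact Set.subset_inter (segment_subset_openStar hs.1 ht.1 hst)
      (segment_subset_openStar hs.2 ht.2 hst)
  refine hconv.isPathConnected ⟨midpoint ℝ (vertexPoint σ) (vertexPoint τ), ?_⟩
  have hmid : midpoint ℝ (vertexPoint σ) (vertexPoint τ) ∈
      homComplex (completeGraphK n) (completeGraphK (n + 1)) := by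
    refine segment_subset_homComplex hσ.1 hτ.1 (fun i j hij a ha => ?_) (midpoint_mem_segment _ _)
    rw [eq_of_vertexPoint_ne_zero ha]
    exact Pi.single_eq_of_ne (injectionGraph_ne_of_ne h hij) _
  have hnn (ρ : Fin n ↪ Fin (n + 1)) (i a) : 0 ≤ vertexPoint ρ i a :=
    ((mem_homComplex_iff.1 (vertexPoint_mem_openStar ρ).1).1 i).1 a
  have hval (i a) : midpoint ℝ (vertexPoint σ) (vertexPoint τ) i a =
      (vertexPoint σ i a + vertexPoint τ i a) / 2 := by
    simp [midpoint_eq_smul_add, div_eq_inv_mul]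
  refine ⟨⟨hmid, fun i => ?_⟩, hmid, fun i => ?_⟩
  · rw [hval]
    linarith [hσ.2 i, hnn τ i (σ i)]
  · rw [hval]
    linarith [hτ.2 i, hnn σ i (τ i)]

/-- The open stars of the vertices cover the complex in the pattern of the injection graph. -/
theorem isGraphCover_openStar :
    IsGraphCover (X := homComplex (completeGraphK n) (completeGraphK (n + 1)))
      (injectionGraph n) fun σ => Subtype.val ⁻¹' openStar σ where
  isOpen σ := by
    have : (Subtype.val ⁻¹' openStar σ :
        Set (homComplex (completeGraphK n) (completeGraphK (n + 1)))) =
        ⋂ i, {t | 0 < t.1 i (σ i)} := by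
      ext t
      simp [openStar]
    rw [this]
    exact isOpen_iInter_of_finite fun i => isOpen_lt continuous_const
      ((continuous_apply_apply i (σ i)).comp continuous_subtype_val)
  exists_mem t := by
    obtain ⟨η, -, hη⟩ := exists_isVertex_iff t.2
    obtain ⟨σ, hσ⟩ := η.exists_vertex
    exact ⟨σ, (hη σ).1 hσ⟩
  isSimplyConnected σ := by
    rw [← Topology.IsEmbedding.subtypeVal.isSimplyConnected_image, Subtype.image_preimage_coe,
      Set.inter_eq_right.2 fun t ht => ht.1]
    exact isSimplyConnected_openStar σ
  isPathConnected_inter {σ τ} h := by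
    rw [← Set.preimage_inter, Topology.IsInducing.subtypeVal.isPathConnected_iff,
      Subtype.image_preimage_coe, Set.inter_eq_right.2 fun t ht => ht.1.1]
    exact isPathConnected_openStar_inter h
  adj {σ τ t} hσ hτ hne := by
    obtain ⟨η, -, hη⟩ := exists_isVertex_iff t.2
    exact ((hη σ).2 hσ).adj ((hη τ).2 hτ) hne
  eq_or_eq_or_eq {ρ σ τ t} hρ hσ hτ := by
    obtain ⟨η, -, hη⟩ := exists_isVertex_iff t.2
    exact ((hη ρ).2 hρ).eq_or_eq_or_eq ((hη σ).2 hσ) ((hη τ).2 hτ)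

end OpenStar

theorem proposition3p3 (n : ℕ) :
    -- the complex is a graph (it has no cells of dimension greater than one),
    (∀ η : HomCell (completeGraphK n) (completeGraphK (n + 1)), η.dim ≤ 1) ∧
    -- it has `(n + 1)!` vertices,
    {σ : HomCell (completeGraphK n) (completeGraphK (n + 1)) | σ.dim = 0}.ncard
      = Nat.factorial (n + 1) ∧
    -- every vertex lies on exactly `n` edges,
    (∀ σ : HomCell (completeGraphK n) (completeGraphK (n + 1)), σ.dim = 0 →
      {η : HomCell (completeGraphK n) (completeGraphK (n + 1)) |
        η.dim = 1 ∧ σ.IsFace η}.ncard = n) ∧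
    -- it is connected,
    PathConnectedSpace (homComplex (completeGraphK n) (completeGraphK (n + 1))) ∧
    -- and its fundamental group is free of rank `α = e - v + 1`
    ∃ α : ℕ,
      (α : ℚ) = (Nat.factorial n : ℚ) * (((n : ℚ) ^ 2 - (n : ℚ) - 2) / 2) + 1 ∧
      (α : ℤ) =
        ({η : HomCell (completeGraphK n) (completeGraphK (n + 1)) |
            η.dim = 1}.ncard : ℤ)
        - ({σ : HomCell (completeGraphK n) (completeGraphK (n + 1)) |
            σ.dim = 0}.ncard : ℤ) + 1 ∧
      ∀ x : homComplex (completeGraphK n) (completeGraphK (n + 1)),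
        Nonempty (FundamentalGroup
          (homComplex (completeGraphK n) (completeGraphK (n + 1))) x
            ≃* FreeGroup (Fin α)) := by
  have hΓ := connected_injectionGraph (n := n)
  refine ⟨HomCell.dim_le_one, ncard_dim_eq_zero, fun η hη => ?_,
    isGraphCover_openStar.pathConnectedSpace hΓ, ?_⟩
  · obtain ⟨σ, hσ⟩ := η.exists_vertex
    rw [eq_vertexCell hη hσ, ncard_edges_at_eq, ncard_incidenceSet]
  · obtain ⟨p, hp⟩ := hΓ.exists_isParent Fin.castSuccEmb
    have hα := hp.ncard_nonTreeEdges
    refine ⟨_, ?_, ?_, isGraphCover_openStar.nonempty_fundamentalGroup_mulEquiv hΓ hα⟩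
    · have he := two_mul_ncard_edgeSet (n := n)
      rw [Nat.card_eq_fintype_card, card_embedding_fin_succ] at hα
      rw [Nat.factorial_succ] at he hα
      -- The formula is compared over `ℚ`, as `n ^ 2 - n - 2` is negative for `n ≤ 1`.
      qify at he hα
      linarith
    · rw [Nat.card_eq_fintype_card, card_embedding_fin_succ] at hα
      rw [ncard_dim_eq_one, ncard_dim_eq_zero]
      omega
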